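/- Let $k$ be an algebraically closed field, let $n\ge 3$, and let $\Gamma\subset\mathbb{P}^n_k$ be a set of $n+2$ distinct points in general linear position, i.e. no $n+1$ of them lie on a hyperplane. Let $R=k[x_0,\ldots,x_n]$, $\mathfrak{m}=(x_0,\ldots,x_n)$, and let $J=\bigcap_{p\in\Gamma}I(p)\subset R$ be the homogeneous ideal of $\Gamma$, where $I(p)$ is generated by the homogeneous polynomials vanishing at $p$. Let $f_1,\ldots,f_m$ be any finite system of homogeneous generators of $J$ (for instance a minimal one), let $\Theta=(\partial f_i/\partial x_j)$ be its Jacobian matrix, let $I_n(\Theta)$ be the ideal generated by the $n\times n$ minors of $\Theta$, and put $I=(J,I_n(\Theta))$. Then $$I_n(\Theta)=\mathfrak{m}^n,$$ and the pair $J\subset I$ is Aluffi torsion-free, i.e. its Valabrega--Valla module $\bigoplus_{t\ge 2}(J\cap I^t)/JI^{t-1}$ is zero; equivalently, $J\cap I^t=JI^{t-1}$ for all $t\ge 1$. -/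

import Mathlib

open MvPolynomial
open scoped LinearAlgebra.Projectivization DirectSum

/-- A finite set `Γ` of points of `ℙⁿ` is in general linear position if either `#Γ ≤ n` and the
points span a `ℙ^(#Γ - 1)` (the lines they represent span a subspace of dimension `#Γ`), or
`#Γ ≥ n + 1` and no `n + 1` of the points lie on a common hyperplane. -/
def InGeneralLinearPosition {k : Type*} [Field k] {n : ℕ}
    (Γ : Finset (ℙ k (Fin (n + 1) → k))) : Prop :=
  (Γ.card ≤ n ∧
    Module.finrank k (⨆ p ∈ Γ, p.submodule : Submodule k (Fin (n + 1) → k)) = Γ.card) ∨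
  (n + 1 ≤ Γ.card ∧
    ∀ S : Finset (ℙ k (Fin (n + 1) → k)), S ⊆ Γ → S.card = n + 1 →
      ¬ ∃ H : Submodule k (Fin (n + 1) → k),
        Module.finrank k H = n ∧ ∀ p ∈ S, p.submodule ≤ H)

/-- The homogeneous ideal `I(p)` of a point `p ∈ ℙⁿ`, generated by the homogeneous polynomials
vanishing at `p` (vanishing does not depend on the chosen representative). -/
noncomputable def pointIdeal {k : Type*} [Field k] {n : ℕ} (p : ℙ k (Fin (n + 1) → k)) :
    Ideal (MvPolynomial (Fin (n + 1)) k) :=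
  Ideal.span {f | (∃ d : ℕ, f.IsHomogeneous d) ∧ eval p.rep f = 0}

/-- The defining ideal `⋂ I(p)`, `p ∈ Γ`, of a finite set of points. -/
noncomputable def idealOfPoints {k : Type*} [Field k] {n : ℕ} (Γ : Finset (ℙ k (Fin (n + 1) → k))) :
    Ideal (MvPolynomial (Fin (n + 1)) k) :=
  ⨅ p ∈ Γ, pointIdeal p

/-- The irrelevant ideal `(x₀, …, xₙ)`. -/
noncomputable def irrelevantIdeal (k : Type*) [Field k] (n : ℕ) : Ideal (MvPolynomial (Fin (n + 1)) k) :=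
  Ideal.span (Set.range X)

/-- The Jacobian matrix `(∂fᵢ/∂xⱼ)`. -/
noncomputable def jacobianMatrix {k : Type*} [Field k] {m n : ℕ}
    (f : Fin m → MvPolynomial (Fin (n + 1)) k) :
    Matrix (Fin m) (Fin (n + 1)) (MvPolynomial (Fin (n + 1)) k) :=
  Matrix.of fun i j => pderiv j (f i)

/-- The ideal `I_r(M)` generated by the `r × r` minors of `M`. -/
def minorsIdeal {R : Type*} [CommRing R] {ι κ : Type*} (r : ℕ) (M : Matrix ι κ R) : Ideal R :=
  Ideal.span {d | ∃ (a : Fin r ↪ ι) (b : Fin r ↪ κ), d = (M.submatrix a b).det}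

/-- The Valabrega–Valla module `⨁_{t ≥ 2} (J ∩ I^t) / J I^(t-1)` of a pair of ideals `J ⊆ I`. -/
abbrev ValabregaVallaModule {R : Type*} [CommRing R] (J I : Ideal R) : Type _ :=
  ⨁ t : {t : ℕ // 2 ≤ t},
    (↥(J ⊓ I ^ (t : ℕ)) ⧸ Submodule.comap (J ⊓ I ^ (t : ℕ)).subtype (J * I ^ ((t : ℕ) - 1)))

/-- The pair `J ⊆ I` is Aluffi torsion-free if its Valabrega–Valla module vanishes. -/
def IsAluffiTorsionFree {R : Type*} [CommRing R] (J I : Ideal R) : Prop :=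
  J ≤ I ∧ Subsingleton (ValabregaVallaModule J I)

/-!
The `n + 2` points form a projective frame, so in suitable linear coordinates `y₀, …, yₙ` they are
the coordinate points and the unit point, and `J` is generated by the quadrics
`yₐ y_b - y_c y_d` with `a ≠ b` and `c ≠ d`. These quadrics are `k`-linear combinations of the `fᵢ`,
so by the chain rule their Jacobian minors in the coordinates `y` lie in `I_n(Θ)`. For cubic minors,
explicit determinants yield all monomials of degree three; bordering by a variable missing from a
given monomial raises the degree and settles all `n ≥ 3`. Conversely the entries of `Θ` lie in `𝔪`,
because `J ⊆ 𝔪²`. Finally `I = J + 𝔪ⁿ`, and `J ∩ 𝔪^(e + 2) = J 𝔪^e` because `J` is generated by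
quadrics; as `I^t ⊆ J I^(t - 1) + 𝔪^(n t)`, this gives `J ∩ I^t = J I^(t - 1)`.
-/

section Minors

variable {R ι κ ι' κ' : Type*} [CommRing R] {r : ℕ}

theorem det_submatrix_mem_minorsIdeal (M : Matrix ι κ R) (a : Fin r → ι) (b : Fin r → κ) :
    (M.submatrix a b).det ∈ minorsIdeal r M := by
  by_cases ha : a.Injective
  · by_cases hb : b.Injective
    · exact Ideal.subset_span ⟨⟨a, ha⟩, ⟨b, hb⟩, rfl⟩
    · obtain ⟨i, j, hij, hne⟩ := Function.not_injective_iff.1 hb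
      rw [Matrix.det_zero_of_column_eq hne fun l => by simp [hij]]
      exact zero_mem _
  · obtain ⟨i, j, hij, hne⟩ := Function.not_injective_iff.1 ha
    rw [Matrix.det_zero_of_row_eq hne (by ext l; simp [hij])]
    exact zero_mem _

theorem minorsIdeal_transpose_le (M : Matrix ι κ R) :
    minorsIdeal r M.transpose ≤ minorsIdeal r M := by
  refine Ideal.span_le.2 ?_
  rintro _ ⟨a, b, rfl⟩
  rw [← Matrix.det_transpose, Matrix.transpose_submatrix, Matrix.transpose_transpose]
  exact det_submatrix_mem_minorsIdeal M b a

theorem minorsIdeal_mul_le_right [Fintype ι] (L : Matrix ι' ι R) (M : Matrix ι κ R) :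
    minorsIdeal r (L * M) ≤ minorsIdeal r M := by
  classical
  refine Ideal.span_le.2 ?_
  rintro _ ⟨a, b, rfl⟩
  have rows_eq : (L * M).submatrix a b = fun i => ∑ l, L (a i) l • fun j => M l (b j) := by
    ext i j
    simp [Matrix.mul_apply]
  have det_eq : ((L * M).submatrix a b).det =
      ∑ s : Fin r → ι, (∏ i, L (a i) (s i)) • (M.submatrix s b).det := by
    rw [rows_eq]
    refine (Matrix.detRowAlternating.toMultilinearMap.map_sum _).trans
      (Finset.sum_congr rfl fun s _ => ?_)
    exact Matrix.detRowAlternating.toMultilinearMap.map_smul_univ _ fun i j => M (s i) (b j)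
  rw [SetLike.mem_coe, det_eq]
  exact sum_mem fun s _ => Submodule.smul_mem _ _ (det_submatrix_mem_minorsIdeal M s b)

theorem minorsIdeal_mul_le_left [Fintype κ] (M : Matrix ι κ R) (N : Matrix κ κ' R) :
    minorsIdeal r (M * N) ≤ minorsIdeal r M :=
  calc minorsIdeal r (M * N) = minorsIdeal r (N.transpose * M.transpose).transpose := by
        rw [Matrix.transpose_mul, Matrix.transpose_transpose, Matrix.transpose_transpose]
    _ ≤ minorsIdeal r (N.transpose * M.transpose) := minorsIdeal_transpose_le _
    _ ≤ minorsIdeal r M.transpose := minorsIdeal_mul_le_right _ _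
    _ ≤ minorsIdeal r M := minorsIdeal_transpose_le _

theorem minorsIdeal_le_pow {I : Ideal R} {M : Matrix ι κ R} (h : ∀ i j, M i j ∈ I) :
    minorsIdeal r M ≤ I ^ r := by
  refine Ideal.span_le.2 ?_
  rintro _ ⟨a, b, rfl⟩
  rw [SetLike.mem_coe, Matrix.det_apply]
  refine sum_mem fun σ _ => Submodule.smul_of_tower_mem _ _ ?_
  simpa using Ideal.prod_mem_prod (s := Finset.univ) (I := fun _ : Fin r => I)
    fun i _ => h (a (σ i)) (b i)

-- Expand along the column `j₀`, in which the rows indexed by `a` vanish.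
theorem mul_mem_minorsIdeal_succ {M : Matrix ι κ R} {a : ι' → ι} {b : κ' → κ} (i₀ : ι) {j₀ : κ}
    (h : ∀ i, M (a i) j₀ = 0) {x : R} (hx : x ∈ minorsIdeal r (M.submatrix a b)) :
    M i₀ j₀ * x ∈ minorsIdeal (r + 1) M := by
  suffices minorsIdeal r (M.submatrix a b) ≤
      Submodule.comap (LinearMap.mulLeft R (M i₀ j₀)) (minorsIdeal (r + 1) M) from this hx
  refine Submodule.span_le.2 ?_
  rintro _ ⟨s, t, rfl⟩
  have det_eq : (M.submatrix (Fin.cons i₀ (a ∘ s)) (Fin.cons j₀ (b ∘ t))).det =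
      M i₀ j₀ * ((M.submatrix a b).submatrix s t).det := by
    rw [Matrix.det_succ_column_zero, Fin.sum_univ_succ, Finset.sum_eq_zero fun i _ => by simp [h]]
    simp only [Fin.val_zero, pow_zero, one_mul, Matrix.submatrix_apply, Fin.cons_zero, add_zero]
    rfl
  simp only [SetLike.mem_coe, Submodule.mem_comap, LinearMap.mulLeft_apply]
  rw [← det_eq]
  exact det_submatrix_mem_minorsIdeal M _ _

end Minors

section QuadricMinors

variable {k A ι : Type*} [CommRing k] [CommRing A] [Algebra k A]

/-- The Jacobian matrix `(D j (g i))` of a family of elements with respect to a family of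
derivations. -/
def derivationMatrix {κ : Type*} (D : κ → Derivation k A A) (g : ι → A) : Matrix ι κ A :=
  Matrix.of fun i j => D j (g i)

/-- The differences of two square-free quadratic monomials in the `y i`. -/
def quadricDifferences (y : ι → A) : Set A :=
  {q | ∃ a b c d, a ≠ b ∧ c ≠ d ∧ q = y a * y b - y c * y d}

/-- The ideal of `r × r` minors of the Jacobian matrix of `quadricDifferences y`. -/
def quadricMinors (D : ι → Derivation k A A) (y : ι → A) (r : ℕ) : Ideal A :=
  minorsIdeal r (derivationMatrix D ((↑) : quadricDifferences y → A))

theorem sub_mem_quadricDifferences {y : ι → A} {a b c d : ι} (hab : a ≠ b) (hcd : c ≠ d) :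
    y a * y b - y c * y d ∈ quadricDifferences y :=
  ⟨a, b, c, d, hab, hcd, rfl⟩

variable {D : ι → Derivation k A A} {y : ι → A} {r : ℕ}

theorem det_mem_quadricMinors {g : Fin r → A} (hg : ∀ i, g i ∈ quadricDifferences y)
    (b : Fin r → ι) : (Matrix.of fun i j => D (b j) (g i)).det ∈ quadricMinors D y r :=
  det_submatrix_mem_minorsIdeal (derivationMatrix D ((↑) : quadricDifferences y → A))
    (fun i => ⟨g i, hg i⟩) b

theorem exists_forall_ne_of_lt_card [Fintype ι] (hr : r < Fintype.card ι) (t : Fin r → ι) :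
    ∃ z, ∀ i, t i ≠ z := by
  by_contra! h
  exact (Fintype.card_le_of_surjective t h).not_gt (by simpa using hr)

variable [DecidableEq ι] (hD : ∀ i j, D j (y i) = if i = j then 1 else 0) {o a b c : ι}
include hD

theorem sq_mul_sub_sub_mem_quadricMinors (h : [o, a, b, c].Nodup) :
    y o ^ 2 * (y o - y a - y b) ∈ quadricMinors D y 3 := by
  have hdet := det_mem_quadricMinors (D := D)
    (g := ![y o * y a - y o * y b, y o * y b - y o * y c, y o * y a - y a * y b])
    (fun i => by fin_cases i <;> apply sub_mem_quadricDifferences <;> grind) ![a, b, c]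
  simp only [Matrix.det_fin_three, Matrix.of_apply, Matrix.cons_val, map_sub, Derivation.leibniz,
    smul_eq_mul, hD] at hdet
  grind

theorem mul_mul_add_sub_mem_quadricMinors (h : [o, a, b, c].Nodup) :
    y o * y c * (y a + y o - y c) ∈ quadricMinors D y 3 := by
  have hdet := det_mem_quadricMinors (D := D)
    (g := ![y o * y a - y o * y c, y o * y b - y o * y c, y o * y a - y a * y c])
    (fun i => by fin_cases i <;> apply sub_mem_quadricDifferences <;> grind) ![o, a, b]
  simp only [Matrix.det_fin_three, Matrix.of_apply, Matrix.cons_val, map_sub, Derivation.leibniz,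
    smul_eq_mul, hD] at hdet
  grind

theorem mul_two_mul_add_mem_quadricMinors (h : [o, a, b, c].Nodup) :
    y o * (2 * (y a * y b) + y c * (y o - y a - y b)) ∈ quadricMinors D y 3 := by
  have hdet := det_mem_quadricMinors (D := D)
    (g := ![y o * y a - y o * y c, y o * y b - y o * y c, y o * y a - y a * y b])
    (fun i => by fin_cases i <;> apply sub_mem_quadricDifferences <;> grind) ![o, a, b]
  simp only [Matrix.det_fin_three, Matrix.of_apply, Matrix.cons_val, map_sub, Derivation.leibniz,
    smul_eq_mul, hD] at hdet
  grind

theorem mul_mul_sub_mem_quadricMinors (h : [o, a, b, c].Nodup) :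
    y o * y c * (y a - y b) ∈ quadricMinors D y 3 := by
  convert sub_mem (mul_mul_add_sub_mem_quadricMinors hD h)
    (mul_mul_add_sub_mem_quadricMinors hD (show [o, b, a, c].Nodup by grind)) using 1
  ring

theorem sq_mul_mem_quadricMinors (h : [o, a, b, c].Nodup) :
    y o ^ 2 * y c ∈ quadricMinors D y 3 := by
  convert sub_mem (sub_mem (mul_two_mul_add_mem_quadricMinors hD h)
    (mul_mul_sub_mem_quadricMinors hD (show [o, b, c, a].Nodup by grind)))
    (mul_mul_sub_mem_quadricMinors hD (show [o, a, c, b].Nodup by grind)) using 1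
  ring

theorem pow_three_mem_quadricMinors (h : [o, a, b, c].Nodup) :
    y o ^ 3 ∈ quadricMinors D y 3 := by
  convert add_mem (add_mem (sq_mul_sub_sub_mem_quadricMinors hD h)
    (sq_mul_mem_quadricMinors hD (show [o, b, c, a].Nodup by grind)))
    (sq_mul_mem_quadricMinors hD (show [o, a, c, b].Nodup by grind)) using 1
  ring

theorem mul_mul_mem_quadricMinors (h : [o, a, b, c].Nodup) :
    y o * y a * y c ∈ quadricMinors D y 3 := by
  convert add_mem (sub_mem (mul_mul_add_sub_mem_quadricMinors hD h)
    (sq_mul_mem_quadricMinors hD h))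
    (sq_mul_mem_quadricMinors hD (show [c, a, b, o].Nodup by grind)) using 1
  ring

theorem prod_fin_three_mem_quadricMinors [Fintype ι] (hι : 3 < Fintype.card ι) (t : Fin 3 → ι) :
    ∏ i, y (t i) ∈ quadricMinors D y 3 := by
  have exists_ne (u v w : ι) : ∃ z, u ≠ z ∧ v ≠ z ∧ w ≠ z := by
    simpa [Fin.forall_fin_succ] using exists_forall_ne_of_lt_card hι ![u, v, w]
  have sq_mul_mem (u v : ι) : y u ^ 2 * y v ∈ quadricMinors D y 3 := by
    obtain ⟨w, hw⟩ := exists_ne u v v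
    by_cases huv : u = v
    · obtain ⟨x, hx⟩ := exists_ne u w w
      obtain ⟨z, hz⟩ := exists_ne u w x
      rw [← huv, ← pow_succ]
      exact pow_three_mem_quadricMinors hD (show [u, w, x, z].Nodup by grind)
    · obtain ⟨x, hx⟩ := exists_ne u v w
      exact sq_mul_mem_quadricMinors hD (show [u, w, x, v].Nodup by grind)
  rw [Fin.prod_univ_three]
  by_cases h₀₁ : t 0 = t 1
  · convert sq_mul_mem (t 0) (t 2) using 1
    rw [← h₀₁, sq]
  by_cases h₀₂ : t 0 = t 2
  · convert sq_mul_mem (t 0) (t 1) using 1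
    rw [← h₀₂]; ring
  by_cases h₁₂ : t 1 = t 2
  · convert sq_mul_mem (t 1) (t 0) using 1
    rw [← h₁₂]; ring
  obtain ⟨z, hz⟩ := exists_ne (t 0) (t 1) (t 2)
  exact mul_mul_mem_quadricMinors hD (show [t 0, t 1, z, t 2].Nodup by grind)

-- The bordered minor for the column `z` and the row of the quadric `y z * y a - y b * y c`.
theorem mul_mem_quadricMinors_succ {z : ι} {a b c : {i // i ≠ z}} (hbc : b ≠ c) {x : A}
    (hx : x ∈ quadricMinors (fun i : {i // i ≠ z} => D i) (fun i => y i) r) :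
    y a * x ∈ quadricMinors D y (r + 1) := by
  have hne (i : {i // i ≠ z}) : (i : ι) ≠ z := i.2
  have hsub : quadricDifferences (fun i : {i // i ≠ z} => y i) ⊆ quadricDifferences y := by
    rintro _ ⟨i, j, l, m, hij, hlm, rfl⟩
    exact sub_mem_quadricDifferences (Subtype.coe_ne_coe.2 hij) (Subtype.coe_ne_coe.2 hlm)
  have hDz : ∀ q ∈ quadricDifferences (fun i : {i // i ≠ z} => y i), D z q = 0 := by
    rintro _ ⟨i, j, l, m, -, -, rfl⟩
    simp [hD, hne]
  have hq : y z * y a - y b * y c ∈ quadricDifferences y :=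
    sub_mem_quadricDifferences (hne a).symm (Subtype.coe_ne_coe.2 hbc)
  have hDq : D z (y z * y a - y b * y c) = y a := by simp [hD, hne]
  rw [← hDq]
  exact mul_mem_minorsIdeal_succ (M := derivationMatrix D ((↑) : quadricDifferences y → A))
    (a := Set.inclusion hsub) (b := Subtype.val) ⟨_, hq⟩ (fun q => hDz q q.2) hx

theorem prod_mem_quadricMinors [Fintype ι] (hr : 3 ≤ r) (hι : r < Fintype.card ι) (t : Fin r → ι) :
    ∏ i, y (t i) ∈ quadricMinors D y r := by
  induction r, hr using Nat.le_induction generalizing ι with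
  | base => exact prod_fin_three_mem_quadricMinors hD hι t
  | succ r hr ih =>
    obtain ⟨z, hz⟩ := exists_forall_ne_of_lt_card hι t
    have hcard : r < Fintype.card {i // i ≠ z} := by
      rw [Fintype.card_subtype_compl, Fintype.card_subtype_eq]
      lia
    obtain ⟨b, c, hbc⟩ := Fintype.exists_pair_of_one_lt_card (hcard.trans' (by lia : 1 < r))
    rw [Fin.prod_univ_succ]
    exact mul_mem_quadricMinors_succ hD (a := ⟨t 0, hz 0⟩) hbc
      (ih (fun i j => by simp [hD, Subtype.ext_iff]) hcard fun i => ⟨t i.succ, hz i.succ⟩)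

theorem span_pow_le_quadricMinors [Fintype ι] (hr : 3 ≤ r) (hι : r < Fintype.card ι) :
    Ideal.span (Set.range y) ^ r ≤ quadricMinors D y r := by
  rw [Ideal.span, Submodule.span_pow]
  refine Submodule.span_le.2 fun x hx => ?_
  obtain ⟨u, rfl⟩ := Set.mem_pow.1 hx
  choose t ht using fun i => (u i).2
  simp only [← ht, List.prod_ofFn]
  exact prod_mem_quadricMinors hD hr hι t

end QuadricMinors

theorem derivation_mem_of_mem_sq {R A : Type*} [CommRing R] [CommRing A] [Algebra R A]
    (D : Derivation R A A) {I : Ideal A} {x : A} (hx : x ∈ I ^ 2) : D x ∈ I := by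
  rw [sq] at hx
  induction hx using Submodule.mul_induction_on' with
  | mem_mul_mem a ha b hb =>
    rw [D.leibniz]
    exact add_mem (I.mul_mem_right _ ha) (I.mul_mem_right _ hb)
  | add a _ b _ ha hb => simpa only [map_add] using add_mem ha hb

section Homogeneous

variable {σ R : Type*} [CommRing R] {g : MvPolynomial σ R} {G : Set (MvPolynomial σ R)}
  {d e r : ℕ}

theorem mem_pow_idealOfVars_of_isHomogeneous (hg : g.IsHomogeneous d) : g ∈ idealOfVars σ R ^ d :=
  (mem_pow_idealOfVars_iff' _ _).2 fun _ hm => hg.coeff_eq_zero hm.ne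

theorem homogeneousComponent_eq_zero_of_mem_pow_idealOfVars (hg : g ∈ idealOfVars σ R ^ e)
    (hd : d < e) : homogeneousComponent d g = 0 := by
  ext m
  rw [coeff_homogeneousComponent, coeff_zero]
  split_ifs with hm
  · exact (mem_pow_idealOfVars_iff' _ _).1 hg m (hm ▸ hd)
  · rfl

theorem sub_C_coeff_zero_mem_idealOfVars (g : MvPolynomial σ R) :
    g - C (coeff 0 g) ∈ idealOfVars σ R := by
  rw [← pow_one (idealOfVars σ R), mem_pow_idealOfVars_iff']
  intro m hm
  obtain rfl : m = 0 := (Finsupp.degree_eq_zero_iff m).1 (by lia)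
  simp

theorem homogeneousComponent_mem_span_mul_pow_idealOfVars (hG : ∀ g ∈ G, g.IsHomogeneous r)
    (hg : g ∈ Ideal.span G) (hd : e + r ≤ d) :
    homogeneousComponent d g ∈ Ideal.span G * idealOfVars σ R ^ e := by
  induction hg using Submodule.closure_induction with
  | zero => simp
  | add x y _ _ hx hy => simpa only [map_add] using add_mem hx hy
  | smul_mem a x hx =>
    rw [smul_eq_mul, ← sum_homogeneousComponent a, Finset.sum_mul, map_sum]
    refine sum_mem fun i _ => ?_
    have hax := (homogeneousComponent_isHomogeneous i a).mul (hG x hx)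
    rw [homogeneousComponent_of_mem hax]
    split_ifs with hid
    · have ha := mem_pow_idealOfVars_of_isHomogeneous (homogeneousComponent_isHomogeneous i a)
      rw [mul_comm (Ideal.span G)]
      exact Ideal.mul_mem_mul (Ideal.pow_le_pow_right (by lia) ha) (Ideal.subset_span hx)
    · exact zero_mem _

theorem span_inf_pow_idealOfVars_le (hG : ∀ g ∈ G, g.IsHomogeneous r) (e : ℕ) :
    Ideal.span G ⊓ idealOfVars σ R ^ (e + r) ≤ Ideal.span G * idealOfVars σ R ^ e := by
  rintro g ⟨hg, hpow⟩
  rw [← sum_homogeneousComponent g]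
  refine sum_mem fun d _ => ?_
  by_cases hd : d < e + r
  · rw [homogeneousComponent_eq_zero_of_mem_pow_idealOfVars hpow hd]
    exact zero_mem _
  · exact homogeneousComponent_mem_span_mul_pow_idealOfVars hG hg (not_lt.1 hd)

theorem homogeneousComponent_mem_span_of_mem_ideal_span (hG : ∀ g ∈ G, ∃ d, g.IsHomogeneous d)
    (hpow : G ⊆ (idealOfVars σ R ^ r : Ideal _)) (hg : g ∈ Ideal.span G) :
    homogeneousComponent r g ∈ Submodule.span R G := by
  induction hg using Submodule.closure_induction with
  | zero => simp
  | add x y _ _ hx hy => simpa only [map_add] using add_mem hx hy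
  | smul_mem a x hx =>
    obtain ⟨d, hxd⟩ := hG x hx
    have hmul : (a - C (coeff 0 a)) * x ∈ idealOfVars σ R ^ (r + 1) := by
      rw [pow_succ']
      exact Ideal.mul_mem_mul (sub_C_coeff_zero_mem_idealOfVars a) (hpow hx)
    have hcomp := homogeneousComponent_eq_zero_of_mem_pow_idealOfVars hmul r.lt_succ_self
    rw [sub_mul, map_sub, sub_eq_zero, ← smul_eq_C_mul, map_smul,
      homogeneousComponent_of_mem hxd] at hcomp
    rw [smul_eq_mul, hcomp]
    split_ifs
    · exact Submodule.smul_mem _ _ (Submodule.subset_span hx)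
    · simp

theorem eval_smul_of_isHomogeneous (hg : g.IsHomogeneous d) (c : R) (v : σ → R) :
    eval (c • v) g = c ^ d * eval v g := by
  rw [eval_eq, eval_eq, Finset.mul_sum]
  refine Finset.sum_congr rfl fun m hm => ?_
  simp only [Pi.smul_apply, smul_eq_mul, mul_pow, Finset.prod_mul_distrib,
    Finset.prod_pow_eq_pow_sum, ← hg.degree_eq_sum_deg_support hm]
  ring

end Homogeneous

section Coordinates

variable {k σ ι : Type*} [CommRing k] [Fintype σ]

/-- The derivative in the direction of the vector `b i`, for a family of vectors of `k ^ σ`. -/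
noncomputable def dirDeriv (b : ι → σ → k) (i : ι) :
    Derivation k (MvPolynomial σ k) (MvPolynomial σ k) :=
  ∑ j, b i j • pderiv j

theorem dirDeriv_apply (b : ι → σ → k) (i : ι) (g : MvPolynomial σ k) :
    dirDeriv b i g = ∑ j, b i j • pderiv j g := by
  rw [dirDeriv, ← Derivation.coeFnAddMonoidHom_apply, map_sum]
  simp

variable [DecidableEq σ]

/-- The linear form in the variables `X j` whose evaluation is the functional `φ` on `k ^ σ`. -/
noncomputable def linearForm (φ : Module.Dual k (σ → k)) : MvPolynomial σ k :=
  ∑ j, φ (Pi.single j 1) • X j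

/-- The linear forms dual to a basis of `k ^ σ`, that is, the coordinates with respect to it. -/
noncomputable def dualForm (b : Module.Basis ι k (σ → k)) (i : ι) : MvPolynomial σ k :=
  linearForm (b.coord i)

theorem linearForm_isHomogeneous (φ : Module.Dual k (σ → k)) : (linearForm φ).IsHomogeneous 1 :=
  IsHomogeneous.sum _ _ _ fun j _ =>
    (homogeneousSubmodule σ k 1).smul_mem _ (isHomogeneous_X k j)

theorem sum_apply_single_mul (φ : Module.Dual k (σ → k)) (v : σ → k) :
    ∑ j, φ (Pi.single j 1) * v j = φ v := by
  conv_rhs => rw [pi_eq_sum_univ' v]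
  simp [mul_comm]

theorem eval_linearForm (φ : Module.Dual k (σ → k)) (v : σ → k) : eval v (linearForm φ) = φ v := by
  simp [linearForm, smul_eval, sum_apply_single_mul]

theorem dirDeriv_linearForm (b : ι → σ → k) (i : ι) (φ : Module.Dual k (σ → k)) :
    dirDeriv b i (linearForm φ) = C (φ (b i)) := by
  rw [← sum_apply_single_mul φ (b i), dirDeriv_apply]
  simp [linearForm, pderiv_X, Pi.single_apply, smul_eq_C_mul, mul_comm]

variable (b : Module.Basis ι k (σ → k))

theorem dirDeriv_dualForm [DecidableEq ι] (i j : ι) :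
    dirDeriv b j (dualForm b i) = if i = j then 1 else 0 := by
  rw [dualForm, dirDeriv_linearForm, b.coord_apply, b.repr_self, Finsupp.single_apply]
  simp [apply_ite C, eq_comm]

theorem X_eq_sum_dualForm [Fintype ι] (j : σ) :
    (X j : MvPolynomial σ k) = ∑ i, b i j • dualForm b i := by
  have sum_repr_apply (l : σ) :
      ∑ i, b i j * b.repr (Pi.single l 1) i = if l = j then 1 else 0 := by
    simpa [Pi.single_apply, mul_comm, eq_comm] using congrFun (b.sum_repr (Pi.single l 1)) j
  simp only [dualForm, linearForm, Finset.smul_sum, smul_smul, b.coord_apply]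
  rw [Finset.sum_comm]
  simp [← Finset.sum_smul, sum_repr_apply]

variable [Finite ι]

theorem span_range_dualForm :
    Submodule.span k (Set.range (dualForm b)) = homogeneousSubmodule σ k 1 := by
  cases nonempty_fintype ι
  refine le_antisymm (Submodule.span_le.2 ?_) ?_
  · rintro _ ⟨i, rfl⟩
    exact linearForm_isHomogeneous _
  · rw [homogeneousSubmodule_one_eq_span_X, Submodule.span_le]
    rintro _ ⟨j, rfl⟩
    rw [X_eq_sum_dualForm b j]
    exact sum_mem fun i _ => Submodule.smul_mem _ _ (Submodule.subset_span ⟨i, rfl⟩)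

theorem ideal_span_range_dualForm : Ideal.span (Set.range (dualForm b)) = idealOfVars σ k := by
  have h := congrArg (fun S : Submodule k _ => Ideal.span (S : Set (MvPolynomial σ k)))
    ((span_range_dualForm b).trans homogeneousSubmodule_one_eq_span_X)
  simpa only [Ideal.span, Submodule.span_span_of_tower] using h

end Coordinates

section QuadricGeneration

theorem mul_mul_prod_eq_mul_pow {M ι τ : Type*} [CommMonoid M] {z : ι → M}
    (hz : ∀ a b c d, a ≠ b → c ≠ d → z a * z b = z c * z d) {o p q : ι} (h : [o, p, q].Nodup)
    {a b : ι} (hab : a ≠ b) (s : Finset τ) (t : τ → ι) :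
    z a * z b * ∏ l ∈ s, z (t l) = z o * z p ^ (s.card + 1) := by
  classical
  induction s using Finset.induction_on with
  | empty => simpa using hz a b o p hab (by grind)
  | insert l s hl ih =>
    rw [Finset.prod_insert hl, mul_left_comm, ih, Finset.card_insert_of_notMem hl]
    by_cases ho : t l = o
    · calc z (t l) * (z o * z p ^ (s.card + 1)) = z o * (z o * z p) * z p ^ s.card := by
            rw [ho, pow_succ', mul_assoc, mul_assoc]
        _ = z o * z q * z p ^ (s.card + 1) := by
            rw [hz o p q p (by grind) (by grind), pow_succ', mul_assoc, mul_assoc, mul_assoc]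
        _ = z o * z p ^ (s.card + 1 + 1) := by
            rw [hz o q o p (by grind) (by grind), pow_succ' _ (s.card + 1), mul_assoc]
    · rw [← mul_assoc, hz (t l) o o p ho (by grind), pow_succ' _ (s.card + 1), mul_assoc]

theorem prod_eq_mul_pow {M ι : Type*} [CommMonoid M] {z : ι → M}
    (hz : ∀ a b c d, a ≠ b → c ≠ d → z a * z b = z c * z d) {o p q : ι} (h : [o, p, q].Nodup)
    {e : ℕ} {t : Fin (e + 1) → ι} {i j : Fin (e + 1)} (hij : t i ≠ t j) :
    ∏ l, z (t l) = z o * z p ^ e := by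
  have hj : j ∈ Finset.univ.erase i := by simp [ne_of_apply_ne t hij.symm]
  have hcard : ((Finset.univ.erase i).erase j).card + 1 = e := by
    rw [Finset.card_erase_add_one hj, Finset.card_erase_of_mem (Finset.mem_univ i)]
    simp
  rw [← Finset.mul_prod_erase _ _ (Finset.mem_univ i), ← Finset.mul_prod_erase _ _ hj, ← mul_assoc,
    mul_mul_prod_eq_mul_pow hz h hij, hcard]

variable {k σ ι : Type*} [CommRing k] [Fintype σ] [DecidableEq σ]
  (b : Module.Basis ι k (σ → k))

theorem eval_dualForm [DecidableEq ι] (i j : ι) :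
    eval (b i) (dualForm b j) = if i = j then 1 else 0 := by
  rw [dualForm, eval_linearForm, b.coord_apply, b.repr_self, Finsupp.single_apply]

theorem isHomogeneous_two_of_mem_quadricDifferences {b : Module.Basis ι k (σ → k)}
    {x : MvPolynomial σ k} (hx : x ∈ quadricDifferences (dualForm b)) : x.IsHomogeneous 2 := by
  obtain ⟨i, j, l, m, -, -, rfl⟩ := hx
  exact ((linearForm_isHomogeneous _).mul (linearForm_isHomogeneous _)).sub
    ((linearForm_isHomogeneous _).mul (linearForm_isHomogeneous _))

variable [Fintype ι]

theorem eval_sum_dualForm (j : ι) : eval (∑ i, b i) (dualForm b j) = 1 := by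
  classical
  simp [dualForm, eval_linearForm, Finsupp.single_apply]

variable {b} {g : MvPolynomial σ k} {d e : ℕ}

-- Both sides are linear in `g`, so it suffices to compare them on monomials in the dual forms.
theorem algHom_apply_eq_sum_eval_smul {A : Type*} [CommRing A] [Algebra k A]
    (F : MvPolynomial σ k →ₐ[k] A)
    (hF : ∀ q ∈ quadricDifferences (dualForm b), F q = 0) {o p q : ι} (h : [o, p, q].Nodup)
    (hg : g.IsHomogeneous (e + 1)) :
    F g = ∑ i, eval (b i) g • (F (dualForm b i) ^ (e + 1) - F (dualForm b o) * F (dualForm b p) ^ e)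
      + eval (∑ i, b i) g • (F (dualForm b o) * F (dualForm b p) ^ e) := by
  classical
  have hz (a a' c c' : ι) (ha : a ≠ a') (hc : c ≠ c') :
      F (dualForm b a) * F (dualForm b a') = F (dualForm b c) * F (dualForm b c') := by
    simpa [sub_eq_zero] using hF _ (sub_mem_quadricDifferences ha hc)
  rw [← mem_homogeneousSubmodule, ← homogeneousSubmodule_one_pow, ← span_range_dualForm b,
    Submodule.span_pow] at hg
  induction hg using Submodule.span_induction with
  | zero => simp
  | add x y _ _ hx hy =>
    simp only [map_add, hx, hy, add_smul, Finset.sum_add_distrib]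
    abel
  | smul c x _ hx => simp only [map_smul, hx, smul_eval, mul_smul, Finset.smul_sum, smul_add]
  | mem x hx =>
    obtain ⟨u, rfl⟩ := Set.mem_pow.1 hx
    choose t ht using fun i => (u i).2
    simp only [← ht, List.prod_ofFn, map_prod, eval_dualForm, eval_sum_dualForm,
      Finset.prod_const_one, one_smul]
    by_cases hconst : ∀ l, t l = t 0
    · simp [hconst]
    · push Not at hconst
      obtain ⟨l, hl⟩ := hconst
      have hprod (i : ι) : ∏ l, (if i = t l then (1 : k) else 0) = 0 := by
        by_cases hi : i = t l
        · exact Finset.prod_eq_zero (Finset.mem_univ 0) (if_neg (hi ▸ hl))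
        · exact Finset.prod_eq_zero (Finset.mem_univ l) (if_neg hi)
      simp only [hprod, zero_smul, Finset.sum_const_zero, zero_add]
      exact prod_eq_mul_pow hz h hl

theorem mem_span_quadricDifferences_of_eval_eq_zero (hι : 2 < Fintype.card ι)
    (hg : g.IsHomogeneous d) (hb : ∀ i, eval (b i) g = 0) (hsum : eval (∑ i, b i) g = 0) :
    g ∈ Ideal.span (quadricDifferences (dualForm b)) := by
  obtain _ | e := d
  · rw [← homogeneousComponent_eq_self hg, homogeneousComponent_zero, eval_C] at hsum
    rw [← homogeneousComponent_eq_self hg, homogeneousComponent_zero, hsum, C_0]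
    exact zero_mem _
  · obtain ⟨o, p, q, hop, hoq, hpq⟩ := Fintype.two_lt_card_iff.1 hι
    rw [← Ideal.Quotient.eq_zero_iff_mem, ← Ideal.Quotient.mkₐ_eq_mk k,
      algHom_apply_eq_sum_eval_smul _
        (fun x hx => Ideal.Quotient.eq_zero_iff_mem.2 (Ideal.subset_span hx))
        (show [o, p, q].Nodup by grind) hg]
    simp [hb, hsum]

theorem eval_eq_zero_of_mem_quadricDifferences {x : MvPolynomial σ k}
    (hx : x ∈ quadricDifferences (dualForm b)) :
    (∀ i, eval (b i) x = 0) ∧ eval (∑ i, b i) x = 0 := by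
  classical
  obtain ⟨i, j, l, m, hij, hlm, rfl⟩ := hx
  refine ⟨fun a => ?_, by simp [eval_sum_dualForm]⟩
  simp only [map_sub, map_mul, eval_dualForm]
  grind

end QuadricGeneration

section Points

variable {k : Type*} [Field k]

/-- `Γ` consists of the coordinate points and the unit point of the projective frame given by the
basis `b`. As `b i` and `∑ i, b i` are nonzero, they lie in the line `p.submodule` if and only if
they represent the point `p`. -/
def IsProjectiveFrame {V ι : Type*} [AddCommGroup V] [Module k V] [Fintype ι]
    (b : Module.Basis ι k V) (Γ : Finset (ℙ k V)) : Prop :=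
  ∀ p, p ∈ Γ ↔ (∃ i, b i ∈ p.submodule) ∨ ∑ i, b i ∈ p.submodule

theorem rep_mem_submodule_iff {V : Type*} [AddCommGroup V] [Module k V] {p q : ℙ k V} :
    q.rep ∈ p.submodule ↔ p = q := by
  conv_rhs => rw [eq_comm, ← p.mk_rep, ← q.mk_rep]
  rw [Projectivization.mk_eq_mk_iff' k _ _ q.rep_nonzero p.rep_nonzero, p.submodule_eq,
    Submodule.mem_span_singleton]

theorem eval_eq_zero_iff_of_mem_submodule {σ : Type*} {g : MvPolynomial σ k} {d : ℕ}
    (hg : g.IsHomogeneous d) {p : ℙ k (σ → k)} {v : σ → k} (hv : v ∈ p.submodule) (hv₀ : v ≠ 0) :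
    eval v g = 0 ↔ eval p.rep g = 0 := by
  rw [p.submodule_eq, Submodule.mem_span_singleton] at hv
  obtain ⟨c, rfl⟩ := hv
  rw [eval_smul_of_isHomogeneous hg, mul_eq_zero,
    or_iff_right (pow_ne_zero _ (left_ne_zero_of_smul hv₀))]

theorem mem_submodule_mk {V : Type*} [AddCommGroup V] [Module k V] {v : V} (hv : v ≠ 0) :
    v ∈ (Projectivization.mk k v hv).submodule := by
  rw [Projectivization.submodule_mk]
  exact Submodule.mem_span_singleton_self v

theorem basis_sum_ne_zero {V ι : Type*} [AddCommGroup V] [Module k V] [Fintype ι] [Nonempty ι]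
    (b : Module.Basis ι k V) : ∑ i, b i ≠ 0 := by
  classical
  intro h
  obtain ⟨i⟩ := ‹Nonempty ι›
  have hcoord := congrArg (b.coord i) h
  simp [Finsupp.single_apply] at hcoord

variable {n : ℕ} {Γ : Finset (ℙ k (Fin (n + 1) → k))}

theorem dual_eq_zero_of_vanishing (hcard : Γ.card = n + 2)
    (hΓ : InGeneralLinearPosition Γ) {p : ℙ k (Fin (n + 1) → k)} (hp : p ∈ Γ)
    (φ : Module.Dual k (Fin (n + 1) → k)) (h : ∀ q ∈ Γ, q ≠ p → φ q.rep = 0) : φ = 0 := by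
  classical
  obtain ⟨h', -⟩ | ⟨-, hΓ⟩ := hΓ
  · lia
  by_contra hφ
  refine hΓ (Γ.erase p) (Finset.erase_subset _ _)
    (by rw [Finset.card_erase_of_mem hp, hcard]; rfl) ⟨LinearMap.ker φ, ?_, fun q hq => ?_⟩
  · have hker := Module.Dual.finrank_ker_add_one_of_ne_zero hφ
    rw [Module.finrank_fin_fun] at hker
    lia
  · rw [q.submodule_eq, Submodule.span_singleton_le_iff_mem]
    exact h q (Finset.mem_of_mem_erase hq) (Finset.ne_of_mem_erase hq)

theorem span_rep_eq_top (hcard : Γ.card = n + 2) (hΓ : InGeneralLinearPosition Γ)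
    {p : ℙ k (Fin (n + 1) → k)} (hp : p ∈ Γ) :
    Submodule.span k (Projectivization.rep '' (Γ \ {p})) = ⊤ := by
  by_contra hne
  obtain ⟨φ, hφ, hle⟩ := Submodule.exists_le_ker_of_lt_top _ (lt_top_iff_ne_top.2 hne)
  exact hφ (dual_eq_zero_of_vanishing hcard hΓ hp φ fun q hq hqp =>
    hle (Submodule.subset_span ⟨q, ⟨hq, hqp⟩, rfl⟩))

theorem mem_idealOfPoints_iff {g : MvPolynomial (Fin (n + 1)) k} {d : ℕ} (hg : g.IsHomogeneous d) :
    g ∈ idealOfPoints Γ ↔ ∀ p ∈ Γ, eval p.rep g = 0 := by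
  simp only [idealOfPoints, Ideal.mem_iInf]
  refine forall₂_congr fun p _ => ⟨fun h => ?_, fun h => Ideal.subset_span ⟨⟨d, hg⟩, h⟩⟩
  have hle : pointIdeal p ≤ RingHom.ker (eval p.rep) := Ideal.span_le.2 fun f hf => hf.2
  exact hle h

theorem homogeneousComponent_mem_idealOfPoints {g : MvPolynomial (Fin (n + 1)) k}
    (hg : g ∈ idealOfPoints Γ) (d : ℕ) : homogeneousComponent d g ∈ idealOfPoints Γ := by
  let _ := MvPolynomial.gradedAlgebra (σ := Fin (n + 1)) (R := k)
  exact homogeneousComponent_mem_of_mem (Ideal.IsHomogeneous.iInf₂ fun _ _ =>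
    Ideal.homogeneous_span _ _ fun _ hf => hf.1) hg d

theorem exists_isProjectiveFrame (hcard : Γ.card = n + 2) (hΓ : InGeneralLinearPosition Γ) :
    ∃ b : Module.Basis (Fin (n + 1)) k (Fin (n + 1) → k), IsProjectiveFrame b Γ := by
  classical
  obtain ⟨p₀, hp₀⟩ : Γ.Nonempty := Finset.card_pos.1 (by lia)
  let e : Fin (n + 1) ≃ Γ.erase p₀ :=
    (Finset.equivFinOfCardEq (by rw [Finset.card_erase_of_mem hp₀, hcard]; rfl)).symm
  have mem_iff (p) : p ∈ Γ ↔ (∃ i, p = e i) ∨ p = p₀ := by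
    refine ⟨fun hp => or_iff_not_imp_right.2 fun hne => ?_, ?_⟩
    · exact ⟨e.symm ⟨p, Finset.mem_erase.2 ⟨hne, hp⟩⟩, by simp⟩
    · rintro (⟨i, rfl⟩ | rfl)
      · exact Finset.mem_of_mem_erase (e i).2
      · exact hp₀
  have hspan : ⊤ ≤ Submodule.span k (Set.range fun i => (e i).1.rep) := by
    rw [← span_rep_eq_top hcard hΓ hp₀]
    refine Submodule.span_mono ?_
    rintro _ ⟨q, ⟨hq, hne⟩, rfl⟩
    obtain ⟨i, rfl⟩ := ((mem_iff q).1 hq).resolve_right hne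
    exact ⟨i, rfl⟩
  let B := basisOfTopLeSpanOfCardEqFinrank _ hspan (by simp)
  have hB (i) : B i = (e i).1.rep := by simp [B]
  have hcoord (i) : B.repr p₀.rep i ≠ 0 := fun h₀ => by
    have hzero := dual_eq_zero_of_vanishing hcard hΓ ((mem_iff _).2 (.inl ⟨i, rfl⟩)) (B.coord i)
      fun q hq hne => by
        obtain ⟨j, rfl⟩ | rfl := (mem_iff q).1 hq
        · rw [← hB, B.coord_apply, B.repr_self, Finsupp.single_eq_of_ne]
          rintro rfl
          exact hne rfl
        · exact h₀
    simpa using congrArg (fun φ => φ (B i)) hzero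
  refine ⟨B.unitsSMul fun i => Units.mk0 _ (hcoord i), fun p => ?_⟩
  have hsum : ∑ i, B.unitsSMul (fun i => Units.mk0 _ (hcoord i)) i = p₀.rep := by
    simp [Module.Basis.unitsSMul_apply, Units.smul_def, B.sum_repr]
  rw [hsum, rep_mem_submodule_iff, mem_iff]
  simp only [Module.Basis.unitsSMul_apply, Units.smul_def, Units.val_mk0,
    Submodule.smul_mem_iff _ (hcoord _), hB, rep_mem_submodule_iff]

theorem mem_idealOfPoints_iff_of_isProjectiveFrame {ι : Type*} [Fintype ι] [Nonempty ι]
    {b : Module.Basis ι k (Fin (n + 1) → k)} (hb : IsProjectiveFrame b Γ)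
    {g : MvPolynomial (Fin (n + 1)) k} {d : ℕ} (hg : g.IsHomogeneous d) :
    g ∈ idealOfPoints Γ ↔ (∀ i, eval (b i) g = 0) ∧ eval (∑ i, b i) g = 0 := by
  have hsum := basis_sum_ne_zero b
  rw [mem_idealOfPoints_iff hg]
  refine ⟨fun h => ⟨fun i => ?_, ?_⟩, fun ⟨hi, hsum₀⟩ p hp => ?_⟩
  · have hmem := mem_submodule_mk (k := k) (b.ne_zero i)
    exact (eval_eq_zero_iff_of_mem_submodule hg hmem (b.ne_zero i)).2
      (h _ ((hb _).2 (.inl ⟨i, hmem⟩)))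
  · have hmem := mem_submodule_mk (k := k) hsum
    exact (eval_eq_zero_iff_of_mem_submodule hg hmem hsum).2 (h _ ((hb _).2 (.inr hmem)))
  · obtain ⟨i, hmem⟩ | hmem := (hb p).1 hp
    · exact (eval_eq_zero_iff_of_mem_submodule hg hmem (b.ne_zero i)).1 (hi i)
    · exact (eval_eq_zero_iff_of_mem_submodule hg hmem hsum).1 hsum₀

theorem idealOfPoints_eq_span_quadricDifferences (hn : 2 ≤ n)
    {b : Module.Basis (Fin (n + 1)) k (Fin (n + 1) → k)} (hb : IsProjectiveFrame b Γ) :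
    idealOfPoints Γ = Ideal.span (quadricDifferences (dualForm b)) := by
  refine le_antisymm (fun g hg => ?_) (Ideal.span_le.2 fun q hq => ?_)
  · rw [← sum_homogeneousComponent g]
    refine sum_mem fun d _ => ?_
    have hcomp := homogeneousComponent_isHomogeneous d g
    obtain ⟨hi, hsum⟩ := (mem_idealOfPoints_iff_of_isProjectiveFrame hb hcomp).1
      (homogeneousComponent_mem_idealOfPoints hg d)
    exact mem_span_quadricDifferences_of_eval_eq_zero (by simpa) hcomp hi hsum
  · have hq₂ := isHomogeneous_two_of_mem_quadricDifferences hq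
    exact (mem_idealOfPoints_iff_of_isProjectiveFrame hb hq₂).2
      (eval_eq_zero_of_mem_quadricDifferences hq)

end Points

section AluffiTorsionFree

variable {R : Type*} [CommRing R] {J M I : Ideal R}

theorem sup_pow_succ_le (J N : Ideal R) (s : ℕ) :
    (J ⊔ N) ^ (s + 1) ≤ J * (J ⊔ N) ^ s ⊔ N ^ (s + 1) := by
  induction s with
  | zero => simp
  | succ s ih =>
    have hle : J * N ^ (s + 1) ≤ J * (J ⊔ N) ^ (s + 1) :=
      Ideal.mul_mono_right (Ideal.pow_right_mono le_sup_right _)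
    calc (J ⊔ N) ^ (s + 1 + 1) = (J ⊔ N) ^ (s + 1) * (J ⊔ N) := pow_succ _ _
      _ ≤ (J * (J ⊔ N) ^ s ⊔ N ^ (s + 1)) * (J ⊔ N) := Ideal.mul_mono_left ih
      _ = J * (J ⊔ N) ^ (s + 1) ⊔ (J * N ^ (s + 1) ⊔ N ^ (s + 1 + 1)) := by
        rw [Ideal.sup_mul, mul_assoc, ← pow_succ, Ideal.mul_sup, ← pow_succ, mul_comm _ J]
      _ = J * (J ⊔ N) ^ (s + 1) ⊔ N ^ (s + 1 + 1) := by rw [← sup_assoc, sup_eq_left.2 hle]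

theorem inf_pow_succ_le {N : Ideal R} {s : ℕ}
    (hN : J ⊓ N ^ (s + 1) ≤ J * (J ⊔ N) ^ s) : J ⊓ (J ⊔ N) ^ (s + 1) ≤ J * (J ⊔ N) ^ s :=
  calc J ⊓ (J ⊔ N) ^ (s + 1) ≤ (J * (J ⊔ N) ^ s ⊔ N ^ (s + 1)) ⊓ J := by
        rw [inf_comm]
        exact inf_le_inf_right _ (sup_pow_succ_le J N s)
    _ = J * (J ⊔ N) ^ s ⊔ N ^ (s + 1) ⊓ J := sup_inf_assoc_of_le _ Ideal.mul_le_left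
    _ ≤ J * (J ⊔ N) ^ s := sup_le le_rfl (inf_comm J _ ▸ hN)

theorem inf_sup_pow_eq {r n t : ℕ} (hJM : ∀ e, J ⊓ M ^ (e + r) ≤ J * M ^ e) (hn : r ≤ n)
    (ht : 1 ≤ t) : J ⊓ (J ⊔ M ^ n) ^ t = J * (J ⊔ M ^ n) ^ (t - 1) := by
  obtain ⟨s, rfl⟩ := Nat.exists_eq_add_of_le' ht
  obtain ⟨c, rfl⟩ := Nat.exists_eq_add_of_le' hn
  rw [Nat.add_sub_cancel]
  refine le_antisymm (inf_pow_succ_le ?_) (le_inf Ideal.mul_le_left ?_)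
  · calc J ⊓ (M ^ (c + r)) ^ (s + 1) = J ⊓ M ^ ((c + r) * s + c + r) := by
          rw [← pow_mul, mul_add_one, add_assoc]
      _ ≤ J * M ^ ((c + r) * s + c) := hJM _
      _ ≤ J * (M ^ (c + r)) ^ s := by
          rw [← pow_mul]
          exact Ideal.mul_mono_right (Ideal.pow_le_pow_right (Nat.le_add_right _ _))
      _ ≤ J * (J ⊔ M ^ (c + r)) ^ s := Ideal.mul_mono_right (Ideal.pow_right_mono le_sup_right _)
  · rw [pow_succ']
    exact Ideal.mul_mono_left le_sup_left

theorem isAluffiTorsionFree_of_inf_pow_le (hJI : J ≤ I)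
    (h : ∀ t : ℕ, 2 ≤ t → J ⊓ I ^ t ≤ J * I ^ (t - 1)) : IsAluffiTorsionFree J I := by
  refine ⟨hJI, ?_⟩
  have subsingleton_component (t : {t : ℕ // 2 ≤ t}) : Subsingleton (↥(J ⊓ I ^ (t : ℕ)) ⧸
      Submodule.comap (J ⊓ I ^ (t : ℕ)).subtype (J * I ^ ((t : ℕ) - 1))) := by
    rw [Submodule.Quotient.subsingleton_iff, Submodule.comap_subtype_eq_top]
    exact h t t.2
  exact DFunLike.coe_injective.subsingleton

end AluffiTorsionFree

section Jacobian

variable {k : Type*} [Field k] {n m r : ℕ} {f : Fin m → MvPolynomial (Fin (n + 1)) k} {ι : Type*}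

theorem minorsIdeal_jacobianMatrix_le_pow (hf : ∀ i, f i ∈ irrelevantIdeal k n ^ 2) :
    minorsIdeal r (jacobianMatrix f) ≤ irrelevantIdeal k n ^ r :=
  minorsIdeal_le_pow fun i j => derivation_mem_of_mem_sq (pderiv j) (hf i)

theorem minorsIdeal_derivationMatrix_dirDeriv_le {κ : Type*} {g : κ → MvPolynomial (Fin (n + 1)) k}
    (hg : ∀ i, g i ∈ Submodule.span k (Set.range f)) (b : ι → Fin (n + 1) → k) :
    minorsIdeal r (derivationMatrix (dirDeriv b) g) ≤ minorsIdeal r (jacobianMatrix f) := by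
  choose c hc using fun i => (Submodule.mem_span_range_iff_exists_fun k).1 (hg i)
  let L : Matrix κ (Fin m) (MvPolynomial (Fin (n + 1)) k) := Matrix.of fun i l => C (c i l)
  let B : Matrix (Fin (n + 1)) ι (MvPolynomial (Fin (n + 1)) k) := Matrix.of fun p j => C (b j p)
  have chain_rule : derivationMatrix (dirDeriv b) g = L * jacobianMatrix f * B := by
    ext1 i j
    simp only [derivationMatrix, dirDeriv_apply, jacobianMatrix, L, B, Matrix.mul_apply,
      Matrix.of_apply, ← hc i, map_sum, Derivation.map_smul, C_mul', mul_comm _ (C (b j _))]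
  rw [chain_rule]
  exact (minorsIdeal_mul_le_left _ _).trans (minorsIdeal_mul_le_right _ _)

theorem minorsIdeal_jacobianMatrix_eq_pow [Fintype ι] {b : Module.Basis ι k (Fin (n + 1) → k)}
    (hr : 3 ≤ r) (hι : r < Fintype.card ι) (hf : ∀ i, ∃ d, (f i).IsHomogeneous d)
    (hgen : Ideal.span (Set.range f) = Ideal.span (quadricDifferences (dualForm b))) :
    minorsIdeal r (jacobianMatrix f) = irrelevantIdeal k n ^ r := by
  classical
  have hf₂ (i) : f i ∈ irrelevantIdeal k n ^ 2 := by
    have hle : Ideal.span (quadricDifferences (dualForm b)) ≤ irrelevantIdeal k n ^ 2 :=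
      Ideal.span_le.2 fun q hq =>
        mem_pow_idealOfVars_of_isHomogeneous (isHomogeneous_two_of_mem_quadricDifferences hq)
    exact hle (hgen ▸ Ideal.subset_span (Set.mem_range_self i))
  have hspan (q : quadricDifferences (dualForm b)) : (q : MvPolynomial (Fin (n + 1)) k) ∈
      Submodule.span k (Set.range f) := by
    rw [← homogeneousComponent_eq_self (isHomogeneous_two_of_mem_quadricDifferences q.2)]
    exact homogeneousComponent_mem_span_of_mem_ideal_span (Set.forall_mem_range.2 hf)
      (Set.range_subset_iff.2 hf₂) (hgen ▸ Ideal.subset_span q.2)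
  refine le_antisymm (minorsIdeal_jacobianMatrix_le_pow hf₂) ?_
  calc irrelevantIdeal k n ^ r = Ideal.span (Set.range (dualForm b)) ^ r := by
        rw [ideal_span_range_dualForm]; rfl
    _ ≤ quadricMinors (dirDeriv b) (dualForm b) r :=
        span_pow_le_quadricMinors (dirDeriv_dualForm b) hr hι
    _ ≤ minorsIdeal r (jacobianMatrix f) := minorsIdeal_derivationMatrix_dirDeriv_le hspan b

end Jacobian

theorem proposition4p1_general {k : Type*} [Field k] (n : ℕ) (hn : 3 ≤ n)
    (Γ : Finset (ℙ k (Fin (n + 1) → k))) (hcard : Γ.card = n + 2)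
    (hΓ : InGeneralLinearPosition Γ)
    {m : ℕ} (f : Fin m → MvPolynomial (Fin (n + 1)) k)
    (hf : ∀ i, ∃ d : ℕ, (f i).IsHomogeneous d)
    (hgen : Ideal.span (Set.range f) = idealOfPoints Γ) :
    minorsIdeal n (jacobianMatrix f) = irrelevantIdeal k n ^ n ∧
    IsAluffiTorsionFree (idealOfPoints Γ)
      (idealOfPoints Γ ⊔ minorsIdeal n (jacobianMatrix f)) ∧
    ∀ t : ℕ, 1 ≤ t →
      idealOfPoints Γ ⊓ (idealOfPoints Γ ⊔ minorsIdeal n (jacobianMatrix f)) ^ t =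
        idealOfPoints Γ * (idealOfPoints Γ ⊔ minorsIdeal n (jacobianMatrix f)) ^ (t - 1) := by
  obtain ⟨b, hb⟩ := exists_isProjectiveFrame hcard hΓ
  have quadrics := idealOfPoints_eq_span_quadricDifferences (by lia) hb
  have minors := minorsIdeal_jacobianMatrix_eq_pow hn (by simp) hf (hgen.trans quadrics)
  have inf_le (e : ℕ) :
      idealOfPoints Γ ⊓ irrelevantIdeal k n ^ (e + 2) ≤
        idealOfPoints Γ * irrelevantIdeal k n ^ e := by
    rw [quadrics]
    exact span_inf_pow_idealOfVars_le (fun _ => isHomogeneous_two_of_mem_quadricDifferences) e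
  have inf_eq (t : ℕ) (ht : 1 ≤ t) := inf_sup_pow_eq inf_le (by lia : 2 ≤ n) ht
  rw [minors]
  exact ⟨rfl, isAluffiTorsionFree_of_inf_pow_le le_sup_left
    fun t ht => (inf_eq t (one_le_two.trans ht)).le, inf_eq⟩

theorem proposition4p1 {k : Type*} [Field k] [IsAlgClosed k] (n : ℕ) (hn : 3 ≤ n)
    (Γ : Finset (ℙ k (Fin (n + 1) → k))) (hcard : Γ.card = n + 2)
    (hΓ : InGeneralLinearPosition Γ)
    {m : ℕ} (f : Fin m → MvPolynomial (Fin (n + 1)) k)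
    (hf : ∀ i, ∃ d : ℕ, (f i).IsHomogeneous d)
    (hgen : Ideal.span (Set.range f) = idealOfPoints Γ) :
    minorsIdeal n (jacobianMatrix f) = irrelevantIdeal k n ^ n ∧
    IsAluffiTorsionFree (idealOfPoints Γ)
      (idealOfPoints Γ ⊔ minorsIdeal n (jacobianMatrix f)) ∧
    ∀ t : ℕ, 1 ≤ t →
      idealOfPoints Γ ⊓ (idealOfPoints Γ ⊔ minorsIdeal n (jacobianMatrix f)) ^ t =
        idealOfPoints Γ * (idealOfPoints Γ ⊔ minorsIdeal n (jacobianMatrix f)) ^ (t - 1) :=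
  proposition4p1_general n hn Γ hcard hΓ f hf hgen
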